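/- Let $g\ge 0$ and let $p\in\mathbb R\langle x_1,\dots,x_g\rangle$ be a noncommutative polynomial of degree $d$ (the maximal length of a word occurring in $p$; $d=0$ if $p=0$) that is symmetric, i.e. $p^T=p$, where $q\mapsto q^T$ is the linear involution that reverses words and fixes each $x_j$; on $\mathbb R\langle x,h\rangle$, with $h=(h_1,\dots,h_g)$, it also fixes each $h_j$. Let $$p'(x)[h]=\tfrac{d}{dt}\,p(x+th)\big|_{t=0},\qquad p''(x)[h]=\tfrac{d^2}{dt^2}\,p(x+th)\big|_{t=0}$$ in $\mathbb R\langle x,h\rangle$. For real $\lambda,\delta$ the relaxed Hessian of $p$ is $$p''_{\lambda,\delta}(x)[h]=p''(x)[h]+\delta\sum_{j=1}^g\ \sum_{|m|\le d-1} m(x)^T h_j^2\, m(x)+\lambda\, p'(x)[h]^T p'(x)[h],$$ where $m$ runs over the words in $x$ of length at most $d-1$. The relaxed Hessian of $p$ is positive at $(X,v)\in(\mathbb R^{n\times n}_{sym})^g\times\mathbb R^n$ if for every $\delta>0$ there is $\lambda>0$ such that $\langle p''_{\lambda,\delta}(X)[H]v,v\rangle\ge 0$ for all $H\in(\mathbb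 R^{n\times n}_{sym})^g$. For each $n$ let $\|\cdot\|$ be any norm on $(\mathbb R^{n\times n}_{sym})^g$. Suppose there is $\epsilon>0$ such that the relaxed Hessian of $p$ is positive at $(X,v)$ for all $n\ge1$, all $X\in(\mathbb R^{n\times n}_{sym})^g$ with $\|X\|<\epsilon$ and all $v\in\mathbb R^n$. Then $p$ has degree at most two and $p$ is convex, i.e. for every $n$, all $X,Y\in(\mathbb R^{n\times n}_{sym})^g$ and all $0\le t\le 1$, the matrix $t\,p(X)+(1-t)\,p(Y)-p(tX+(1-t)Y)$ is positive semidefinite. -/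

import Mathlib

open scoped Polynomial

noncomputable section

namespace NCHess

/-- Noncommutative polynomials `ℝ⟨x₁, …, x_g⟩`.  The involution `q ↦ qᵀ` (reversal of words, fixing
every variable) is Mathlib's `star` on the free algebra. -/
abbrev NCPoly (g : ℕ) : Type := FreeAlgebra ℝ (Fin g)

/-- Noncommutative polynomials `ℝ⟨x, h⟩` in the `2 g` symmetric variables
`x₁, …, x_g` (left summand) and `h₁, …, h_g` (right summand). -/
abbrev NCPolyXH (g : ℕ) : Type := FreeAlgebra ℝ (Fin g ⊕ Fin g)

/-- The variable `x_j` in `ℝ⟨x, h⟩`. -/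
def xVar {g : ℕ} (j : Fin g) : NCPolyXH g := FreeAlgebra.ι ℝ (Sum.inl j)

/-- The variable `h_j` in `ℝ⟨x, h⟩`. -/
def hVar {g : ℕ} (j : Fin g) : NCPolyXH g := FreeAlgebra.ι ℝ (Sum.inr j)

/-- The degree: the largest length of a word that occurs in `p` with nonzero coefficient
(with value `0` for `p = 0`). -/
def degree {g : ℕ} (p : NCPoly g) : ℕ :=
  (FreeAlgebra.equivMonoidAlgebraFreeMonoid p).coeff.support.sup FreeMonoid.length

/-- The monomial (word) `x_{w 0} x_{w 1} ⋯ x_{w (k-1)}` of length `k`, as an element of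
`ℝ⟨x, h⟩`. -/
def word {g k : ℕ} (w : Fin k → Fin g) : NCPolyXH g :=
  (List.ofFn fun i => xVar (w i)).prod

/-- `p(x + t h)` as a polynomial in the central variable `t` with coefficients in `ℝ⟨x, h⟩`. -/
def shift {g : ℕ} : NCPoly g →ₐ[ℝ] (NCPolyXH g)[X] :=
  FreeAlgebra.lift ℝ fun j => Polynomial.C (xVar j) + Polynomial.C (hVar j) * Polynomial.X

/-- The directional derivative `p'(x)[h] = d/dt p(x + t h)` at `t = 0`, i.e. the coefficient of `t`
in `p(x + t h)`. -/
def deriv₁ {g : ℕ} (p : NCPoly g) : NCPolyXH g :=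
  (Polynomial.derivative (shift p)).eval 0

/-- The Hessian `p''(x)[h] = d²/dt² p(x + t h)` at `t = 0`. -/
def hessian {g : ℕ} (p : NCPoly g) : NCPolyXH g :=
  (Polynomial.derivative (Polynomial.derivative (shift p))).eval 0

/-- `Ṽ(x)[h]ᵀ Ṽ(x)[h]`: the sum of `(h_j m)ᵀ (h_j m) = mᵀ h_j² m` over `1 ≤ j ≤ g` and all words
`m` in `x` of length less than `d`. -/
def vtv (g d : ℕ) : NCPolyXH g :=
  ∑ k ∈ Finset.range d, ∑ w : Fin k → Fin g, ∑ j : Fin g,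
    star (hVar j * word w) * (hVar j * word w)

/-- The relaxed Hessian `p'' + δ Ṽᵀ Ṽ + λ (p')ᵀ p'`, where the words in `Ṽ` have length at most
`degree p - 1`. -/
def relaxedHessian {g : ℕ} (p : NCPoly g) (lam δ : ℝ) : NCPolyXH g :=
  hessian p + δ • vtv g (degree p) + lam • (star (deriv₁ p) * deriv₁ p)

/-- The real symmetric `n × n` matrices. -/
def symMat (n : ℕ) : Submodule ℝ (Matrix (Fin n) (Fin n) ℝ) where
  carrier := {A | A.IsSymm}
  add_mem' ha hb := Matrix.IsSymm.add ha hb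
  zero_mem' := Matrix.isSymm_zero
  smul_mem' c _ ha := Matrix.IsSymm.smul ha c

/-- The `g`-tuples of real symmetric `n × n` matrices. -/
abbrev SymTuple (g n : ℕ) : Type := Fin g → symMat n

/-- Evaluation `p(X)` at a tuple of symmetric matrices. -/
def evalX {g n : ℕ} (X : SymTuple g n) : NCPoly g →ₐ[ℝ] Matrix (Fin n) (Fin n) ℝ :=
  FreeAlgebra.lift ℝ fun j => (X j : Matrix (Fin n) (Fin n) ℝ)

/-- Evaluation `q(X)[H]` at a pair of tuples of symmetric matrices. -/
def evalXH {g n : ℕ} (X H : SymTuple g n) : NCPolyXH g →ₐ[ℝ] Matrix (Fin n) (Fin n) ℝ :=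
  FreeAlgebra.lift ℝ (Sum.elim
    (fun j => (X j : Matrix (Fin n) (Fin n) ℝ)) (fun j => (H j : Matrix (Fin n) (Fin n) ℝ)))

/-- The relaxed Hessian of `p` is positive at `(X, v)`: for every `δ > 0` there is `λ > 0` with
`0 ≤ ⟨p''_{λ,δ}(X)[H] v, v⟩` for all `H`. -/
def RelaxedHessianPosAt {g n : ℕ} (p : NCPoly g) (X : SymTuple g n) (v : Fin n → ℝ) : Prop :=
  ∀ δ : ℝ, 0 < δ → ∃ lam : ℝ, 0 < lam ∧ ∀ H : SymTuple g n,
    0 ≤ (Matrix.mulVec (evalXH X H (relaxedHessian p lam δ)) v) ⬝ᵥ v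

/-- The relaxed Hessian of `p` is positive on the graded set `S = ⋃_{n ≥ 1} S n`. -/
def RelaxedHessianPosOn {g : ℕ} (p : NCPoly g)
    (S : ∀ n : ℕ, Set (SymTuple g n × (Fin n → ℝ))) : Prop :=
  ∀ n : ℕ, 1 ≤ n → ∀ (X : SymTuple g n) (v : Fin n → ℝ), (X, v) ∈ S n → RelaxedHessianPosAt p X v

/-- The noncommutative `ε`-neighborhood of `0` for norms `N n` on the `g`-tuples of symmetric
`n × n` matrices. -/
def ncNhd {g : ℕ} (N : ∀ n : ℕ, Seminorm ℝ (SymTuple g n)) (ε : ℝ) (n : ℕ) :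
    Set (SymTuple g n × (Fin n → ℝ)) :=
  {z | N n z.1 < ε}

/-- Matrix convexity: `p(tX + (1-t)Y) ⪯ t p(X) + (1-t) p(Y)` for symmetric tuples `X, Y` of every
size and `0 ≤ t ≤ 1`. -/
def MatrixConvex {g : ℕ} (p : NCPoly g) : Prop :=
  ∀ (n : ℕ) (X Y : SymTuple g n) (t : ℝ), 0 ≤ t → t ≤ 1 →
    (t • evalX X p + (1 - t) • evalX Y p - evalX (t • X + (1 - t) • Y) p).PosSemidef

end NCHess

end

open scoped Polynomial

noncomputable section

namespace NCHess

/-! Write `c_w` for the coefficients of `p` and `d` for its degree. On words of length at most `d`,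
let `A_j` be a small multiple of creation plus annihilation of the letter `j`. The vectors `m(A)Ω`,
`Ω` the vacuum, are linearly independent, so any `γ` with `γ [] = 0` is realized by vectors `b_j`
with `⟨b_j, m(A)Ω⟩ = γ (j :: m)` for `|m| ≤ d`. Evaluate at `X = A ⊕ 0`, with `H_j` bordering the
extra coordinate by `b_j`, and at the vector `v = Ω ⊕ 0`. As `X` kills the extra coordinate,
`p'(X)[H]v` is the scalar `∑ c_w γ w` there, and only adjacent pairs of `h`'s survive in
`⟨p''(X)[H]v, v⟩`, which is `2 ∑ c_{aᵀb} γ a γ b` over nonempty `a`.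

If `∑ c_w γ w = 0`, the `λ` term vanishes whatever `λ` is, and letting `δ → 0` makes this form
nonnegative (`sum_coef_splitSum_nonneg`). Adjusting `γ` at one word of length `d` enforces the
constraint without changing the form on words of lengths `1, …, d - 1`, so the form is positive
semidefinite there (`gram_nonneg`). If `d > 2`, a top word `i m` gives a nonzero off-diagonal entry
beside the zero diagonal entry at `m`, which is impossible. If `d ≤ 2`, the matrix `(c_{ij})` is
positive semidefinite, and convexity follows. -/

variable {g : ℕ}

/-! ### Words, coefficients and the involution. -/

/-- The monomial of `ℝ⟨x⟩` given by a list of letters. -/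
def mon (w : List (Fin g)) : NCPoly g := (w.map (FreeAlgebra.ι ℝ)).prod

/-- The coefficient of a word in a noncommutative polynomial. -/
def coef (p : NCPoly g) (w : List (Fin g)) : ℝ :=
  (FreeAlgebra.equivMonoidAlgebraFreeMonoid p).coeff (FreeMonoid.ofList w)

/-- The words that occur in a noncommutative polynomial. -/
def supp (p : NCPoly g) : Finset (List (Fin g)) :=
  (FreeAlgebra.equivMonoidAlgebraFreeMonoid p).coeff.support.map FreeMonoid.toList.toEmbedding

theorem mon_nil : mon ([] : List (Fin g)) = 1 := rfl

theorem mon_cons (j : Fin g) (w : List (Fin g)) :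
    mon (j :: w) = FreeAlgebra.ι ℝ j * mon w := by
  simp [mon]

theorem mem_supp {p : NCPoly g} {w : List (Fin g)} : w ∈ supp p ↔ coef p w ≠ 0 := by
  simp only [supp, coef, Finset.mem_map_equiv, Finsupp.mem_support_iff]
  rfl

theorem equiv_mon (w : List (Fin g)) :
    FreeAlgebra.equivMonoidAlgebraFreeMonoid (mon w) =
      MonoidAlgebra.of ℝ (FreeMonoid (Fin g)) (FreeMonoid.ofList w) := by
  induction w with
  | nil => simp [mon_nil, MonoidAlgebra.one_def]
  | cons j w ih =>
    rw [mon_cons, map_mul, ih, FreeMonoid.ofList_cons, map_mul]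
    congr 1
    simp [FreeAlgebra.equivMonoidAlgebraFreeMonoid]

theorem eq_sum_mon (p : NCPoly g) : p = ∑ w ∈ supp p, coef p w • mon w := by
  apply FreeAlgebra.equivMonoidAlgebraFreeMonoid.injective
  rw [map_sum, supp, Finset.sum_map]
  simp only [map_smul, equiv_mon]
  conv_lhs => rw [← MonoidAlgebra.sum_coeff_single (FreeAlgebra.equivMonoidAlgebraFreeMonoid p)]
  rw [Finsupp.sum]
  refine Finset.sum_congr rfl fun w _ => ?_
  simp [coef]

theorem coef_mon (u w : List (Fin g)) : coef (mon u) w = if u = w then 1 else 0 := by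
  rw [coef, equiv_mon]
  exact Finsupp.single_apply (α := List (Fin g)) (a := u) (a' := w) (b := (1 : ℝ))

/-- The coefficient of a word, as a linear functional. -/
def coefLin (w : List (Fin g)) : NCPoly g →ₗ[ℝ] ℝ where
  toFun p := coef p w
  map_add' p q := by simp [coef]
  map_smul' c p := by simp [coef]

theorem length_le_degree {p : NCPoly g} {w : List (Fin g)} (h : w ∈ supp p) :
    w.length ≤ degree p := by
  rw [supp, Finset.mem_map_equiv] at h
  exact Finset.le_sup (f := FreeMonoid.length) h

theorem coef_eq_zero_of_degree_lt {p : NCPoly g} {w : List (Fin g)} (h : degree p < w.length) :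
    coef p w = 0 := by
  by_contra hw
  exact absurd (length_le_degree (mem_supp.2 hw)) (by omega)

theorem exists_coef_ne_zero_of_degree_pos {p : NCPoly g} (h : 0 < degree p) :
    ∃ w, w.length = degree p ∧ coef p w ≠ 0 := by
  have hne : (FreeAlgebra.equivMonoidAlgebraFreeMonoid p).coeff.support.Nonempty := by
    rw [Finset.nonempty_iff_ne_empty]
    intro h0
    rw [degree, h0] at h
    simp at h
  obtain ⟨w, hw, hd⟩ := Finset.exists_mem_eq_sup _ hne FreeMonoid.length
  exact ⟨FreeMonoid.toList w, hd.symm, Finsupp.mem_support_iff.1 hw⟩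

theorem star_mon (w : List (Fin g)) : star (mon w) = mon w.reverse := by
  induction w with
  | nil => simp [mon]
  | cons j w ih => rw [mon_cons, star_mul, ih, FreeAlgebra.star_ι]; simp [mon]

theorem star_smul_nc {α : Type*} (c : ℝ) (p : FreeAlgebra ℝ α) : star (c • p) = c • star p := by
  rw [Algebra.smul_def, star_mul, FreeAlgebra.star_algebraMap, Algebra.smul_def,
    Algebra.commutes]

theorem coef_star (p : NCPoly g) (w : List (Fin g)) : coef (star p) w = coef p w.reverse := by
  have h1 : star p = ∑ u ∈ supp p, coef p u • mon u.reverse := by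
    conv_lhs => rw [eq_sum_mon p]
    simp [star_sum, star_smul_nc, star_mon]
  have h2 : coef (star p) w = coefLin w (star p) := rfl
  have h3 : coef p w.reverse = coefLin w.reverse p := rfl
  rw [h2, h3, h1]
  conv_rhs => rw [eq_sum_mon p]
  simp only [map_sum, map_smul]
  refine Finset.sum_congr rfl fun u _ => ?_
  change coef p u • coef (mon u.reverse) w = coef p u • coef (mon u) w.reverse
  simp only [coef_mon, List.reverse_eq_iff]

theorem sum_supp_ite (p : NCPoly g) (u : List (Fin g)) :
    ∑ w ∈ supp p, coef p w * (if u = w then 1 else 0) = coef p u := by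
  simp only [mul_ite, mul_one, mul_zero, Finset.sum_ite_eq, mem_supp]
  split_ifs with h
  · rfl
  · exact (not_not.1 h).symm

/-! ### Summing over factorizations of words. -/

/-- The sum of `γ (rᵀ) γ s` over the factorizations `mᵀ w = r s` in which `s` is a proper
suffix of `w`. -/
def splitSum (γ : List (Fin g) → ℝ) : List (Fin g) → List (Fin g) → ℝ
  | [], _ => 0
  | j :: q, m => γ q * γ (j :: m) + splitSum γ q (j :: m)

theorem splitSum_eq (γ : List (Fin g) → ℝ) (F : Finset (List (Fin g)))
    (hF : ∀ a, γ a ≠ 0 → a ∈ F) (w m : List (Fin g)) :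
    splitSum γ w m = ∑ a ∈ F, ∑ b ∈ F,
      if a.reverse ++ b = m.reverse ++ w ∧ m.length < a.length then γ a * γ b else 0 := by
  induction w generalizing m with
  | nil =>
    symm
    refine Finset.sum_eq_zero fun a _ => Finset.sum_eq_zero fun b _ => if_neg ?_
    rintro ⟨h, hl⟩
    have := congrArg List.length h
    simp at this
    omega
  | cons j q ih =>
    -- Either the cut falls right after `j`, forcing `a = j :: m` and `b = q`, or `a` is longer
    -- still.
    have hsplit : ∀ a b : List (Fin g),
        (if a.reverse ++ b = m.reverse ++ j :: q ∧ m.length < a.length then γ a * γ b else 0) =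
        (if j :: m = a then (if q = b then γ a * γ b else 0) else 0) +
        (if a.reverse ++ b = (j :: m).reverse ++ q ∧ (j :: m).length < a.length
          then γ a * γ b else 0) := by
      intro a b
      by_cases ha : j :: m = a
      · subst ha
        simp [eq_comm]
      · have : (a.reverse ++ b = m.reverse ++ j :: q ∧ m.length < a.length) ↔
            (a.reverse ++ b = (j :: m).reverse ++ q ∧ (j :: m).length < a.length) := by
          simp only [List.reverse_cons, List.append_assoc, List.singleton_append,
            List.length_cons]
          refine and_congr_right fun h => ⟨fun hl => ?_, fun hl => by omega⟩
          by_contra hl'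
          apply ha
          have h' : a.reverse ++ b = (j :: m).reverse ++ q := by simpa using h
          have := (List.append_inj h' (by simp; omega)).1
          exact (List.reverse_injective this).symm
        simp only [this, ha, if_false, zero_add]
    simp only [hsplit, Finset.sum_add_distrib, splitSum, ih]
    congr 1
    by_cases h1 : γ (j :: m) = 0
    · rw [h1, mul_zero]
      refine (Finset.sum_eq_zero fun a _ => Finset.sum_eq_zero fun b _ => ?_).symm
      split_ifs with h2 h3
      · rw [← h2, h1, zero_mul]
      all_goals rfl
    · rw [Finset.sum_eq_single_of_mem (j :: m) (hF _ h1)]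
      · by_cases h3 : γ q = 0
        · rw [h3, zero_mul]
          refine (Finset.sum_eq_zero fun b _ => ?_).symm
          rw [if_pos rfl]
          split_ifs with h2
          · rw [← h2, h3, mul_zero]
          · rfl
        · rw [Finset.sum_eq_single_of_mem q (hF _ h3)]
          · simp [mul_comm]
          · intro b _ hb
            simp [hb.symm]
      · intro a _ ha
        simp [ha.symm]

theorem sum_coef_splitSum (p : NCPoly g) (γ : List (Fin g) → ℝ) (h0 : γ [] = 0)
    (F : Finset (List (Fin g))) (hF : ∀ a, γ a ≠ 0 → a ∈ F) :
    ∑ w ∈ supp p, coef p w * splitSum γ w [] =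
      ∑ a ∈ F, ∑ b ∈ F, coef p (a.reverse ++ b) * (γ a * γ b) := by
  simp only [splitSum_eq γ F hF, Finset.mul_sum]
  rw [Finset.sum_comm]
  refine Finset.sum_congr rfl fun a _ => ?_
  rw [Finset.sum_comm]
  refine Finset.sum_congr rfl fun b _ => ?_
  rw [← sum_supp_ite, Finset.sum_mul]
  refine Finset.sum_congr rfl fun w _ => ?_
  by_cases ha : a = []
  · subst ha
    simp [h0]
  · have : 0 < a.length := List.length_pos_of_ne_nil ha
    simp [this]

/-! ### Taylor coefficients of `p(x + t h)`. -/

theorem shift_ι_mul (j : Fin g) (q : NCPoly g) :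
    shift (FreeAlgebra.ι ℝ j * q) =
      (Polynomial.C (xVar j) + Polynomial.C (hVar j) * Polynomial.X) * shift q := by
  rw [map_mul]
  simp [shift]

theorem coeff_zero_shift_mon_cons (j : Fin g) (q : List (Fin g)) :
    (shift (mon (j :: q))).coeff 0 = xVar j * (shift (mon q)).coeff 0 := by
  rw [mon_cons, shift_ι_mul, add_mul, mul_assoc]
  simp

theorem coeff_succ_shift_mon_cons (j : Fin g) (q : List (Fin g)) (k : ℕ) :
    (shift (mon (j :: q))).coeff (k + 1) =
      xVar j * (shift (mon q)).coeff (k + 1) + hVar j * (shift (mon q)).coeff k := by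
  rw [mon_cons, shift_ι_mul, add_mul, mul_assoc]
  simp

theorem deriv₁_eq (p : NCPoly g) : deriv₁ p = (shift p).coeff 1 := by
  rw [deriv₁, ← Polynomial.coeff_zero_eq_eval_zero, Polynomial.coeff_derivative]
  simp

theorem hessian_eq (p : NCPoly g) : hessian p = (2 : ℝ) • (shift p).coeff 2 := by
  rw [hessian, ← Polynomial.coeff_zero_eq_eval_zero, Polynomial.coeff_derivative,
    Polynomial.coeff_derivative, two_smul]
  simp [one_add_one_eq_two, mul_two]

theorem coeff_shift (p : NCPoly g) (k : ℕ) :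
    (shift p).coeff k = ∑ w ∈ supp p, coef p w • (shift (mon w)).coeff k := by
  conv_lhs => rw [eq_sum_mon p]
  simp

/-! ### Evaluation at padded and bordered matrices. -/

section Eval

variable {ι : Type*} [Fintype ι] [DecidableEq ι]

/-- Evaluation of `ℝ⟨x, h⟩` at square matrices with an arbitrary finite index type. -/
def matEval (X H : Fin g → Matrix ι ι ℝ) : NCPolyXH g →ₐ[ℝ] Matrix ι ι ℝ :=
  FreeAlgebra.lift ℝ (Sum.elim X H)

@[simp] theorem matEval_xVar (X H : Fin g → Matrix ι ι ℝ) (j : Fin g) :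
    matEval X H (xVar j) = X j := by
  simp [matEval, xVar]

@[simp] theorem matEval_hVar (X H : Fin g → Matrix ι ι ℝ) (j : Fin g) :
    matEval X H (hVar j) = H j := by
  simp [matEval, hVar]

end Eval

section Block

variable {U : Type*}

/-- The matrix `A ⊕ 0`. -/
def padBlock (A : Matrix U U ℝ) : Matrix (U ⊕ Unit) (U ⊕ Unit) ℝ :=
  Matrix.fromBlocks A 0 0 0

/-- The symmetric matrix with off-diagonal blocks `b` and `bᵀ`. -/
def borderBlock (b : U → ℝ) : Matrix (U ⊕ Unit) (U ⊕ Unit) ℝ :=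
  Matrix.fromBlocks 0 (Matrix.replicateCol Unit b) (Matrix.replicateRow Unit b) 0

theorem borderBlock_isSymm (b : U → ℝ) : (borderBlock b).IsSymm := by
  refine Matrix.IsSymm.fromBlocks ?_ ?_ ?_
  · exact Matrix.isSymm_zero
  · simp
  · exact Matrix.isSymm_zero

theorem padBlock_isSymm {A : Matrix U U ℝ} (hA : A.IsSymm) : (padBlock A).IsSymm :=
  Matrix.IsSymm.fromBlocks hA (by simp) Matrix.isSymm_zero

theorem padBlock_smul (η : ℝ) (A : Matrix U U ℝ) :
    padBlock (η • A) = η • padBlock A := by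
  simp [padBlock, Matrix.fromBlocks_smul]

variable [Fintype U]

/-- The vector `m(A) v`. -/
def monVec (A : Fin g → Matrix U U ℝ) (v : U → ℝ) (m : List (Fin g)) : U → ℝ :=
  m.foldr (fun j u => (A j).mulVec u) v

theorem padBlock_mulVec (A : Matrix U U ℝ) (u : U → ℝ) (c : Unit → ℝ) :
    (padBlock A).mulVec (Sum.elim u c) = Sum.elim (A.mulVec u) 0 := by
  simp [padBlock, Matrix.fromBlocks_mulVec]

theorem borderBlock_mulVec (b u : U → ℝ) (c : Unit → ℝ) :
    (borderBlock b).mulVec (Sum.elim u c) = Sum.elim (c () • b) (fun _ => b ⬝ᵥ u) := by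
  rw [borderBlock, Matrix.fromBlocks_mulVec]
  ext i
  rcases i with i | i <;>
    simp [Matrix.mulVec, dotProduct, Matrix.replicateCol, Matrix.replicateRow, mul_comm]

variable [DecidableEq U] (A : Fin g → Matrix U U ℝ) (v : U → ℝ) (b : Fin g → U → ℝ) (γ : List (Fin g) → ℝ) (D : ℕ)

local notation "Ev" => matEval (fun j => padBlock (A j)) (fun j => borderBlock (b j))

theorem coeff_zero_mon_mulVec (m : List (Fin g)) :
    (Ev ((shift (mon m)).coeff 0)).mulVec (Sum.elim v 0) = Sum.elim (monVec A v m) 0 := by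
  induction m with
  | nil => simp [mon_nil, monVec]
  | cons j q ih =>
    rw [coeff_zero_shift_mon_cons, map_mul, ← Matrix.mulVec_mulVec, ih, matEval_xVar,
      padBlock_mulVec]
    rfl

/-- An `h` sends the vector to the extra coordinate, where any further `x` gives zero; only the term
with `h` leftmost survives. -/
theorem coeff_one_mon_mulVec (h0 : γ [] = 0)
    (hγ : ∀ j m, m.length ≤ D → b j ⬝ᵥ monVec A v m = γ (j :: m))
    (w : List (Fin g)) (hw : w.length ≤ D + 1) :
    (Ev ((shift (mon w)).coeff 1)).mulVec (Sum.elim v 0) = Sum.elim (0 : U → ℝ) (fun _ : Unit => γ w) := by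
  induction w with
  | nil =>
    ext i
    rcases i with i | i <;> simp [mon_nil, h0, Polynomial.coeff_one]
  | cons j q ih =>
    rw [List.length_cons] at hw
    rw [coeff_succ_shift_mon_cons, map_add, map_mul, map_mul, Matrix.add_mulVec,
      ← Matrix.mulVec_mulVec, ← Matrix.mulVec_mulVec, ih (by omega), coeff_zero_mon_mulVec,
      matEval_xVar, matEval_hVar, padBlock_mulVec, borderBlock_mulVec, hγ j q (by omega)]
    ext i
    rcases i with i | i <;> simp

/-- The pairing with every `m` is carried along because symmetry of `A j` moves a leading letter of
`w` onto `m`, exactly as in the recursion for `splitSum`. -/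
theorem coeff_two_mon_mulVec (hA : ∀ j, (A j).IsSymm) (h0 : γ [] = 0)
    (hγ : ∀ j m, m.length ≤ D → b j ⬝ᵥ monVec A v m = γ (j :: m))
    (w : List (Fin g)) (hw : w.length ≤ D + 1) :
    ∃ y : U → ℝ, (Ev ((shift (mon w)).coeff 2)).mulVec (Sum.elim v 0) = Sum.elim y 0 ∧
      ∀ m : List (Fin g), w.length + m.length ≤ D + 1 → y ⬝ᵥ monVec A v m = splitSum γ w m := by
  induction w with
  | nil =>
    refine ⟨0, ?_, fun m _ => by simp [splitSum]⟩
    ext i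
    rcases i with i | i <;> simp [mon_nil, Polynomial.coeff_one]
  | cons j q ih =>
    rw [List.length_cons] at hw
    obtain ⟨y, hy, hm⟩ := ih (by omega)
    refine ⟨(A j).mulVec y + γ q • b j, ?_, fun m hl => ?_⟩
    · rw [coeff_succ_shift_mon_cons, map_add, map_mul, map_mul, Matrix.add_mulVec,
        ← Matrix.mulVec_mulVec, ← Matrix.mulVec_mulVec, hy,
        coeff_one_mon_mulVec A v b γ D h0 hγ q (by omega),
        matEval_xVar, matEval_hVar, padBlock_mulVec, borderBlock_mulVec]
      ext i
      rcases i with i | i <;> simp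
    · rw [List.length_cons] at hl
      have h1 := hm (j :: m) (by rw [List.length_cons]; omega)
      have h2 : (A j).mulVec y ⬝ᵥ monVec A v m = y ⬝ᵥ monVec A v (j :: m) := by
        change _ = y ⬝ᵥ (A j).mulVec (monVec A v m)
        rw [Matrix.dotProduct_mulVec, ← Matrix.mulVec_transpose, (hA j).eq]
      rw [add_dotProduct, smul_dotProduct, hγ j m (by omega), h2, h1, splitSum, smul_eq_mul]
      ring

theorem matEval_deriv₁_mulVec (p : NCPoly g) (hD : degree p ≤ D + 1) (h0 : γ [] = 0)
    (hγ : ∀ j m, m.length ≤ D → b j ⬝ᵥ monVec A v m = γ (j :: m)) :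
    (Ev (deriv₁ p)).mulVec (Sum.elim v 0) =
      Sum.elim (0 : U → ℝ) (fun _ : Unit => ∑ w ∈ supp p, coef p w * γ w) := by
  rw [deriv₁_eq, coeff_shift, map_sum, Matrix.sum_mulVec]
  have : ∀ w ∈ supp p, (Ev (coef p w • (shift (mon w)).coeff 1)).mulVec (Sum.elim v 0) =
      coef p w • Sum.elim (0 : U → ℝ) (fun _ : Unit => γ w) := fun w hw => by
    rw [map_smul, Matrix.smul_mulVec, coeff_one_mon_mulVec A v b γ D h0 hγ w
      ((length_le_degree hw).trans hD)]
  rw [Finset.sum_congr rfl this]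
  ext i
  rcases i with i | i <;> simp

theorem matEval_hessian_dotProduct (p : NCPoly g) (hD : degree p ≤ D + 1)
    (hA : ∀ j, (A j).IsSymm) (h0 : γ [] = 0)
    (hγ : ∀ j m, m.length ≤ D → b j ⬝ᵥ monVec A v m = γ (j :: m)) :
    (Ev (hessian p)).mulVec (Sum.elim v 0) ⬝ᵥ Sum.elim v 0 =
      2 * ∑ w ∈ supp p, coef p w * splitSum γ w [] := by
  rw [hessian_eq, map_smul, Matrix.smul_mulVec, smul_dotProduct, coeff_shift, map_sum,
    Matrix.sum_mulVec, sum_dotProduct, smul_eq_mul]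
  congr 1
  refine Finset.sum_congr rfl fun w hw => ?_
  have hl := (length_le_degree hw).trans hD
  obtain ⟨y, hy, hm⟩ := coeff_two_mon_mulVec A v b γ D hA h0 hγ w hl
  rw [map_smul, Matrix.smul_mulVec, smul_dotProduct, hy, ← hm [] (by simpa using hl), smul_eq_mul]
  simp [monVec]

end Block

/-! ### Truncated Fock space. -/

section Fock

variable (g) in
/-- Words of length at most `D`. -/
abbrev Words (D : ℕ) : Type := {w : List (Fin g) // w.length ≤ D}

instance (D : ℕ) : Fintype (Words g D) := (List.finite_length_le (Fin g) D).fintype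

/-- The sum of the creation operator of the letter `j` and its adjoint, on words of length at
most `D`. -/
def fockMatrix (D : ℕ) (j : Fin g) : Matrix (Words g D) (Words g D) ℝ :=
  Matrix.of fun u w => if u.1 = j :: w.1 ∨ w.1 = j :: u.1 then 1 else 0

theorem fockMatrix_apply (D : ℕ) (j : Fin g) (u w : Words g D) :
    fockMatrix D j u w = if u.1 = j :: w.1 ∨ w.1 = j :: u.1 then 1 else 0 :=
  rfl

theorem fockMatrix_isSymm (D : ℕ) (j : Fin g) : (fockMatrix D j).IsSymm := by
  ext u w
  simp [fockMatrix, or_comm]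

/-- The vacuum vector. -/
def vacuum (g D : ℕ) : Words g D → ℝ := Pi.single ⟨[], Nat.zero_le D⟩ 1

/-- Triangularity: `m(A)Ω` is `η ^ |m|` times the basis vector of `m` plus shorter words, since
annihilation only shortens. -/
theorem monVec_fock (D : ℕ) (η : ℝ) (m : List (Fin g)) (u : Words g D)
    (hu : m.length ≤ u.1.length) :
    monVec (fun j => η • fockMatrix D j) (vacuum g D) m u =
      if u.1 = m then η ^ m.length else 0 := by
  induction m generalizing u with
  | nil =>
    obtain ⟨u, hu'⟩ := u
    simp [monVec, vacuum, Pi.single_apply]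
  | cons j q ih =>
    rw [List.length_cons] at hu
    change (η • fockMatrix D j).mulVec (monVec _ _ q) u = _
    rw [Matrix.smul_mulVec, Pi.smul_apply, Matrix.mulVec, dotProduct, smul_eq_mul]
    have key : ∀ w : Words g D,
        fockMatrix D j u w * monVec (fun j => η • fockMatrix D j) (vacuum g D) q w =
          if u.1 = j :: q ∧ w.1 = q then η ^ q.length else 0 := by
      intro w
      rw [fockMatrix_apply]
      split_ifs with h1 h2 h2
      · rw [ih w (by rw [h2.2]), if_pos h2.2, one_mul]
      · have hl : q.length ≤ w.1.length := by
          rcases h1 with h1 | h1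
          · have := congrArg List.length h1
            rw [List.length_cons] at this
            omega
          · rw [h1, List.length_cons]
            omega
        rw [ih w hl, one_mul, if_neg]
        rintro rfl
        rcases h1 with h1 | h1
        · exact h2 ⟨h1, rfl⟩
        · have := congrArg List.length h1
          rw [List.length_cons] at this
          omega
      · exact absurd (Or.inl (by rw [h2.1, h2.2])) h1
      · rw [zero_mul]
    rw [Finset.sum_congr rfl fun w _ => key w]
    split_ifs with h
    · have hq : q.length ≤ D := by
        have := u.2
        omega
      rw [Finset.sum_eq_single ⟨q, hq⟩]
      · simp [h, pow_succ, mul_comm]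
      · intro w _ hw
        rw [if_neg]
        rintro ⟨-, h'⟩
        exact hw (Subtype.ext h')
      · simp
    · simp [h]

theorem exists_dotProduct_monVec_fock (D : ℕ) {η : ℝ} (hη : η ≠ 0) (β : List (Fin g) → ℝ) :
    ∃ b : Words g D → ℝ, ∀ m : List (Fin g), m.length ≤ D →
      b ⬝ᵥ monVec (fun j => η • fockMatrix D j) (vacuum g D) m = β m := by
  classical
  let M : Matrix (Words g D) (Words g D) ℝ :=
    Matrix.of fun m u => monVec (fun j => η • fockMatrix D j) (vacuum g D) m.1 u
  have hli : LinearIndependent ℝ M.row := by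
    rw [Fintype.linearIndependent_iff]
    intro c hc
    by_contra! hne
    -- At a longest word `m` of a linear relation, no other term of the relation has an
    -- `m`-coordinate.
    obtain ⟨m, hm, hmax⟩ := (Finset.univ.filter fun m => c m ≠ 0).exists_max_image
      (fun m => m.1.length) (by obtain ⟨i, hi⟩ := hne; exact ⟨i, by simpa using hi⟩)
    simp only [Finset.mem_filter, Finset.mem_univ, true_and] at hm hmax
    have h1 := congrFun hc m
    rw [Finset.sum_apply, Finset.sum_eq_single m] at h1
    · simp only [Pi.smul_apply, Matrix.row, M, Matrix.of_apply, smul_eq_mul, Pi.zero_apply] at h1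
      rw [monVec_fock D η m.1 m le_rfl, if_pos rfl] at h1
      exact (mul_ne_zero hm (pow_ne_zero _ hη)) h1
    · intro m' _ hm'
      by_cases hc' : c m' = 0
      · simp [hc']
      · simp only [Pi.smul_apply, Matrix.row, M, Matrix.of_apply, smul_eq_mul]
        rw [monVec_fock D η m'.1 m (hmax m' hc'), if_neg, mul_zero]
        exact fun h => hm' (Subtype.ext h.symm)
    · simp
  have hu : IsUnit M.det :=
    (Matrix.isUnit_iff_isUnit_det _).1 (Matrix.linearIndependent_rows_iff_isUnit.1 hli)
  refine ⟨M⁻¹.mulVec fun m => β m.1, fun m hm => ?_⟩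
  have h2 : M.mulVec (M⁻¹.mulVec fun m => β m.1) ⟨m, hm⟩ = β m := by
    rw [Matrix.mulVec_mulVec, Matrix.mul_nonsing_inv _ hu, Matrix.one_mulVec]
  rw [dotProduct_comm]
  exact h2

end Fock

/-! ### Reindexing to `Fin n`. -/

section Transport

variable {ι : Type*} [Fintype ι] [DecidableEq ι] {n : ℕ}

/-- A tuple of symmetric matrices, reindexed to `Fin n`. -/
def reindexTuple (e : ι ≃ Fin n) (X : Fin g → Matrix ι ι ℝ) (hX : ∀ j, (X j).IsSymm) :
    SymTuple g n :=
  fun j => ⟨(X j).submatrix e.symm e.symm, (hX j).submatrix _⟩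

theorem evalXH_reindexTuple (e : ι ≃ Fin n) (X H : Fin g → Matrix ι ι ℝ)
    (hX : ∀ j, (X j).IsSymm) (hH : ∀ j, (H j).IsSymm) (q : NCPolyXH g) :
    evalXH (reindexTuple e X hX) (reindexTuple e H hH) q =
      (matEval X H q).submatrix e.symm e.symm := by
  have : evalXH (reindexTuple e X hX) (reindexTuple e H hH) =
      (Matrix.reindexAlgEquiv ℝ ℝ e).toAlgHom.comp (matEval X H) := by
    apply FreeAlgebra.hom_ext
    ext j : 1
    rcases j with j | j <;> simp [evalXH, matEval, reindexTuple]
  rw [this]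
  rfl

theorem evalXH_reindexTuple_dotProduct (e : ι ≃ Fin n) (X H : Fin g → Matrix ι ι ℝ)
    (hX : ∀ j, (X j).IsSymm) (hH : ∀ j, (H j).IsSymm) (q : NCPolyXH g) (v : ι → ℝ) :
    (evalXH (reindexTuple e X hX) (reindexTuple e H hH) q).mulVec (v ∘ e.symm) ⬝ᵥ (v ∘ e.symm) =
      (matEval X H q).mulVec v ⬝ᵥ v := by
  rw [evalXH_reindexTuple, Matrix.submatrix_mulVec_equiv, Equiv.symm_symm, Function.comp_assoc,
    Equiv.symm_comp_self, Function.comp_id, comp_equiv_dotProduct_comp_equiv]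

end Transport

/-! ### Consequences of positivity for the coefficients. -/

theorem exists_relaxedHessianPosAt {p : NCPoly g} {N : ∀ n : ℕ, Seminorm ℝ (SymTuple g n)}
    {ε : ℝ} (hε : 0 < ε) (hpos : RelaxedHessianPosOn p (ncNhd N ε)) {n : ℕ} (hn : 1 ≤ n)
    (X : SymTuple g n) : ∃ η : ℝ, η ≠ 0 ∧ ∀ v, RelaxedHessianPosAt p (η • X) v := by
  have hN := apply_nonneg (N n) X
  have hη : 0 < ε / (N n X + 1) := by positivity
  refine ⟨ε / (N n X + 1), hη.ne', fun v => hpos n hn _ v ?_⟩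
  change N n (_ • X) < ε
  rw [map_smul_eq_mul, Real.norm_of_nonneg hη.le, div_mul_eq_mul_div, div_lt_iff₀ (by linarith)]
  nlinarith

theorem sum_coef_splitSum_nonneg {p : NCPoly g} {N : ∀ n : ℕ, Seminorm ℝ (SymTuple g n)}
    {ε : ℝ} (hε : 0 < ε) (hpos : RelaxedHessianPosOn p (ncNhd N ε))
    (γ : List (Fin g) → ℝ) (h0 : γ [] = 0) (hγ : ∑ w ∈ supp p, coef p w * γ w = 0) :
    0 ≤ ∑ w ∈ supp p, coef p w * splitSum γ w [] := by
  set D := degree p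
  let e := Fintype.equivFin (Words g D ⊕ Unit)
  have hn : 1 ≤ Fintype.card (Words g D ⊕ Unit) := Fintype.card_pos
  obtain ⟨η, hη, hpos⟩ := exists_relaxedHessianPosAt hε hpos hn
    (reindexTuple e (fun j => padBlock (fockMatrix D j))
      fun j => padBlock_isSymm (fockMatrix_isSymm D j))
  have hA : ∀ j, (η • fockMatrix (g := g) D j).IsSymm := fun j => (fockMatrix_isSymm D j).smul η
  choose b hb using fun j => exists_dotProduct_monVec_fock D hη fun m : List (Fin g) => γ (j :: m)
  set V : Words g D ⊕ Unit → ℝ := Sum.elim (vacuum g D) 0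
  have hX : η • reindexTuple e (fun j => padBlock (fockMatrix (g := g) D j))
      (fun j => padBlock_isSymm (fockMatrix_isSymm D j)) =
      reindexTuple e (fun j => padBlock (η • fockMatrix D j)) fun j => padBlock_isSymm (hA j) := by
    funext j
    apply Subtype.ext
    change η • (padBlock (fockMatrix D j)).submatrix e.symm e.symm =
      (padBlock (η • fockMatrix D j)).submatrix e.symm e.symm
    rw [padBlock_smul]
    rfl
  rw [hX] at hpos
  have hD : degree p ≤ D + 1 := Nat.le_succ _
  have hd := matEval_deriv₁_mulVec _ (vacuum g D) b γ D p hD h0 hb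
  have hh := matEval_hessian_dotProduct _ (vacuum g D) b γ D p hD hA h0 hb
  set E := matEval (fun j => padBlock (η • fockMatrix D j)) (fun j => borderBlock (b j))
  set Q := ∑ w ∈ supp p, coef p w * splitSum γ w []
  set K := (E (vtv g (degree p))).mulVec V ⬝ᵥ V
  rw [hγ] at hd
  have hd0 : (E (deriv₁ p)).mulVec V = 0 := by
    rw [hd]
    ext i
    rcases i with i | i <;> rfl
  have key : ∀ δ : ℝ, 0 < δ → 0 ≤ 2 * Q + δ * K := by
    intro δ hδ
    obtain ⟨lam, -, hlam⟩ := hpos (V ∘ e.symm) δ hδ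
    have := hlam (reindexTuple e (fun j => borderBlock (b j)) fun j => borderBlock_isSymm (b j))
    rw [evalXH_reindexTuple_dotProduct] at this
    change 0 ≤ (E _).mulVec V ⬝ᵥ V at this
    rw [relaxedHessian, map_add, map_add, map_smul, map_smul, map_mul, Matrix.add_mulVec,
      Matrix.add_mulVec, Matrix.smul_mulVec, Matrix.smul_mulVec, ← Matrix.mulVec_mulVec, hd0,
      Matrix.mulVec_zero, smul_zero, add_zero, add_dotProduct, smul_dotProduct, hh,
      smul_eq_mul] at this
    exact this
  by_contra! hQ
  have hK : 0 < |K| + 1 := by positivity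
  -- This `δ` is small enough that `δ K ≤ -Q`, leaving `2 Q + δ K ≤ Q < 0`.
  have h1 := key (-Q / (|K| + 1)) (div_pos (by linarith) hK)
  have h2 : -Q / (|K| + 1) * K ≤ -Q := by
    rw [div_mul_eq_mul_div, div_le_iff₀ hK]
    nlinarith [le_abs_self K]
  linarith

/-- A top-degree word joined to any nonempty word exceeds the degree, so changing `γ` there is free
and absorbs the linear constraint. -/
theorem gram_nonneg {p : NCPoly g} {N : ∀ n : ℕ, Seminorm ℝ (SymTuple g n)}
    {ε : ℝ} (hε : 0 < ε) (hpos : RelaxedHessianPosOn p (ncNhd N ε))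
    (F : Finset (List (Fin g))) (hF : ∀ a ∈ F, 1 ≤ a.length ∧ a.length < degree p)
    (γ : List (Fin g) → ℝ) (hγ : ∀ a, γ a ≠ 0 → a ∈ F) :
    0 ≤ ∑ a ∈ F, ∑ b ∈ F, coef p (a.reverse ++ b) * (γ a * γ b) := by
  rcases F.eq_empty_or_nonempty with rfl | ⟨a₀, ha₀⟩
  · simp
  have hd : 0 < degree p := by
    have := hF a₀ ha₀
    omega
  obtain ⟨w₀, hw₀, hc⟩ := exists_coef_ne_zero_of_degree_pos hd
  have hwF : w₀ ∉ F := fun h => by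
    have := hF w₀ h
    omega
  have hne : w₀ ≠ [] := fun h => by simp [h] at hw₀; omega
  -- Solves `∑ coef p w * γ' w = 0`.
  set t := -(∑ w ∈ supp p, coef p w * γ w) / coef p w₀
  let γ' : List (Fin g) → ℝ := fun w => γ w + t * (if w₀ = w then 1 else 0)
  have hγF : ∀ a ∈ F, γ' a = γ a := fun a ha => by
    have : w₀ ≠ a := fun h => hwF (h ▸ ha)
    simp [γ', this]
  have h0 : γ' [] = 0 := by
    have : γ [] = 0 := by
      by_contra h
      have := hF _ (hγ _ h)
      simp at this
    simp [γ', hne, this]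
  have hsum : ∑ w ∈ supp p, coef p w * γ' w = 0 := by
    have : ∀ w ∈ supp p, coef p w * γ' w =
        coef p w * γ w + t * (coef p w * (if w₀ = w then 1 else 0)) := fun w _ => by
      simp only [γ']
      ring
    rw [Finset.sum_congr rfl this, Finset.sum_add_distrib, ← Finset.mul_sum, sum_supp_ite,
      div_mul_cancel₀ _ hc, add_neg_cancel]
  have key := sum_coef_splitSum_nonneg hε hpos γ' h0 hsum
  rw [sum_coef_splitSum p γ' h0 (insert w₀ F) fun a ha => ?_] at key
  · have hz : ∀ a ∈ insert w₀ F, ∀ b ∈ insert w₀ F, a = w₀ ∨ b = w₀ →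
        coef p (a.reverse ++ b) = 0 := by
      have hl : ∀ a ∈ insert w₀ F, 1 ≤ a.length := fun a ha => by
        rcases Finset.mem_insert.1 ha with rfl | ha
        · omega
        · exact (hF a ha).1
      intro a ha b hb hab
      apply coef_eq_zero_of_degree_lt
      rw [List.length_append, List.length_reverse]
      have := hl a ha
      have := hl b hb
      rcases hab with rfl | rfl <;> omega
    rw [Finset.sum_insert hwF, Finset.sum_eq_zero fun b hb => by
      rw [hz w₀ (Finset.mem_insert_self _ _) b hb (Or.inl rfl), zero_mul], zero_add] at key
    refine key.trans_eq (Finset.sum_congr rfl fun a ha => ?_)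
    rw [Finset.sum_insert hwF, hz a (Finset.mem_insert_of_mem ha) w₀ (Finset.mem_insert_self _ _)
      (Or.inr rfl), zero_mul, zero_add]
    exact Finset.sum_congr rfl fun b hb => by rw [hγF a ha, hγF b hb]
  · rw [Finset.mem_insert]
    by_cases h : w₀ = a
    · exact Or.inl h.symm
    · exact Or.inr (hγ a (by simpa [γ', h] using ha))

theorem degree_le_two {p : NCPoly g} (hp : star p = p) {N : ∀ n : ℕ, Seminorm ℝ (SymTuple g n)}
    {ε : ℝ} (hε : 0 < ε) (hpos : RelaxedHessianPosOn p (ncNhd N ε)) : degree p ≤ 2 := by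
  by_contra! hd
  obtain ⟨w₀, hw₀, hc⟩ := exists_coef_ne_zero_of_degree_pos (p := p) (by omega)
  rcases w₀ with - | ⟨i, m⟩
  · simp at hw₀
    omega
  rw [List.length_cons] at hw₀
  have him : [i] ≠ m := fun h => by simp [← h] at hw₀; omega
  set c := coef p (i :: m)
  -- Chosen so that the form takes the value `coef p [i, i] + 2 c s = -1`.
  set s := -(coef p [i, i] + 1) / (2 * c)
  have key := gram_nonneg hε hpos {[i], m}
    (by
      intro a ha
      simp only [Finset.mem_insert, Finset.mem_singleton] at ha
      rcases ha with rfl | rfl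
      · simp
        omega
      · omega)
    (fun w => if w = [i] then 1 else if w = m then s else 0)
    (by
      intro a ha
      by_contra h
      simp only [Finset.mem_insert, Finset.mem_singleton, not_or] at h
      simp [h] at ha)
  have h1 : coef p (m.reverse ++ [i]) = c := by
    rw [← List.reverse_cons, ← coef_star, hp]
  have h2 : coef p (m.reverse ++ m) = 0 := by
    apply coef_eq_zero_of_degree_lt
    simp
    omega
  rw [Finset.sum_pair him, Finset.sum_pair him, Finset.sum_pair him, h1, h2] at key
  simp only [List.reverse_singleton, List.singleton_append, if_true, if_neg him.symm] at key
  have h3 : s * (2 * c) = -(coef p [i, i] + 1) := div_mul_cancel₀ _ (by simpa using hc)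
  change 0 ≤ coef p [i, i] * (1 * 1) + c * (1 * s) + (c * (s * 1) + 0 * (s * s)) at key
  linarith

theorem quadratic_coef_nonneg {p : NCPoly g} {N : ∀ n : ℕ, Seminorm ℝ (SymTuple g n)}
    {ε : ℝ} (hε : 0 < ε) (hpos : RelaxedHessianPosOn p (ncNhd N ε)) (hd : degree p ≤ 2)
    (α : Fin g → ℝ) : 0 ≤ ∑ i, ∑ j, coef p [i, j] * (α i * α j) := by
  rcases hd.lt_or_eq with hd | hd
  · refine (Finset.sum_eq_zero fun i _ => Finset.sum_eq_zero fun j _ => ?_).ge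
    rw [coef_eq_zero_of_degree_lt (by simpa using hd), zero_mul]
  · have key := gram_nonneg hε hpos
      (Finset.univ.image fun i : Fin g => [i])
      (by
        intro a ha
        obtain ⟨i, -, rfl⟩ := Finset.mem_image.1 ha
        simp [hd])
      (fun w => match w with
        | [i] => α i
        | _ => 0)
      (by
        intro a ha
        rcases a with - | ⟨i, - | ⟨j, a⟩⟩
        · simp at ha
        · simp
        · simp at ha)
    have hinj : Set.InjOn (fun i : Fin g => [i]) (Finset.univ : Finset (Fin g)) :=
      fun i _ j _ h => by simpa using h
    rw [Finset.sum_image hinj, Finset.sum_congr rfl fun i _ => Finset.sum_image hinj] at key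
    exact key

/-! ### Convexity in degree at most two. -/

/-- The convexity defect `t p(X) + (1 - t) p(Y) - p(t X + (1 - t) Y)`, linear in `p`. -/
def convexityDefect {n : ℕ} (X Y : SymTuple g n) (t : ℝ) :
    NCPoly g →ₗ[ℝ] Matrix (Fin n) (Fin n) ℝ :=
  t • (evalX X).toLinearMap + (1 - t) • (evalX Y).toLinearMap -
    (evalX (t • X + (1 - t) • Y)).toLinearMap

theorem convexityDefect_eq {n : ℕ} (X Y : SymTuple g n) (t : ℝ) {p : NCPoly g}
    (hd : degree p ≤ 2) :
    convexityDefect X Y t p = (t * (1 - t)) • ∑ i, ∑ j, coef p [i, j] •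
      (((X i - Y i : symMat n) : Matrix (Fin n) (Fin n) ℝ) * (X j - Y j : symMat n)) := by
  have h2 : ∀ i j : Fin g, convexityDefect X Y t (mon [i, j]) = (t * (1 - t)) •
      (((X i - Y i : symMat n) : Matrix (Fin n) (Fin n) ℝ) * (X j - Y j : symMat n)) := by
    intro i j
    simp only [convexityDefect, mon, evalX, LinearMap.sub_apply, LinearMap.add_apply,
      LinearMap.smul_apply, AlgHom.toLinearMap_apply, List.map_cons, List.map_nil,
      List.prod_cons, List.prod_nil, mul_one, map_mul, FreeAlgebra.lift_ι_apply, Pi.add_apply,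
      Pi.smul_apply, Submodule.coe_add, Submodule.coe_smul, Submodule.coe_sub]
    simp only [add_mul, mul_add, sub_mul, mul_sub, smul_mul_assoc, mul_smul_comm]
    module
  have h01 : ∀ w : List (Fin g), w.length < 2 → convexityDefect X Y t (mon w) = 0 := by
    intro w hw
    rcases w with - | ⟨i, - | ⟨j, w⟩⟩
    · simp only [convexityDefect, mon_nil, LinearMap.sub_apply, LinearMap.add_apply,
        LinearMap.smul_apply, AlgHom.toLinearMap_apply, map_one]
      module
    · simp [convexityDefect, mon, evalX]
    · simp at hw
  conv_lhs => rw [eq_sum_mon p]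
  have hG : ∑ w ∈ supp p, convexityDefect X Y t (coef p w • mon w) =
      ∑ w ∈ Finset.univ.image fun ij : Fin g × Fin g => [ij.1, ij.2],
        convexityDefect X Y t (coef p w • mon w) := by
    refine Finset.sum_congr_of_eq_on_inter (fun w hw hw' => ?_) (fun w _ hw' => ?_)
      fun _ _ _ => rfl
    · rw [map_smul, h01 w, smul_zero]
      refine lt_of_le_of_ne ((length_le_degree hw).trans hd) fun h => hw' ?_
      obtain ⟨i, j, rfl⟩ := List.length_eq_two.1 h
      simp
    · rw [mem_supp, not_not] at hw'
      rw [hw', zero_smul, map_zero]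
  rw [map_sum, hG, Finset.sum_image fun _ _ _ _ h => by simpa [Prod.ext_iff] using h,
    Fintype.sum_prod_type, Finset.smul_sum]
  refine Finset.sum_congr rfl fun i _ => ?_
  rw [Finset.smul_sum]
  refine Finset.sum_congr rfl fun j _ => ?_
  rw [map_smul, smul_comm (t * (1 - t)), ← h2]

theorem matrixConvex_of_degree_le_two {p : NCPoly g} (hp : star p = p) (hd : degree p ≤ 2)
    (hA : ∀ α : Fin g → ℝ, 0 ≤ ∑ i, ∑ j, coef p [i, j] * (α i * α j)) : MatrixConvex p := by
  intro n X Y t ht0 ht1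
  change (convexityDefect X Y t p).PosSemidef
  rw [convexityDefect_eq X Y t hd]
  refine Matrix.PosSemidef.smul ?_ (mul_nonneg ht0 (by linarith))
  have hD : ∀ i, (((X i - Y i : symMat n) : Matrix (Fin n) (Fin n) ℝ)).IsSymm :=
    fun i => (X i - Y i).2
  generalize hE : (fun i => ((X i - Y i : symMat n) : Matrix (Fin n) (Fin n) ℝ)) = E
  have hE' : ∀ i, ((X i - Y i : symMat n) : Matrix (Fin n) (Fin n) ℝ) = E i := fun i => by
    rw [← hE]
  simp only [hE'] at hD ⊢
  refine Matrix.PosSemidef.of_dotProduct_mulVec_nonneg ?_ fun x => ?_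
  · rw [Matrix.IsHermitian, Matrix.conjTranspose_eq_transpose_of_trivial]
    simp only [Matrix.transpose_sum, Matrix.transpose_smul, Matrix.transpose_mul, (hD _).eq]
    rw [Finset.sum_comm]
    refine Finset.sum_congr rfl fun i _ => Finset.sum_congr rfl fun j _ => ?_
    congr 1
    conv_lhs => rw [← hp, coef_star]
    rfl
  -- Coordinate by coordinate, this is the scalar form at `α i = (E i x) k`.
  · have : star x ⬝ᵥ (∑ i, ∑ j, coef p [i, j] • (E i * E j)).mulVec x =
        ∑ k, ∑ i, ∑ j, coef p [i, j] * ((E i).mulVec x k * (E j).mulVec x k) := by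
      have hij : ∀ i j, x ⬝ᵥ (E i * E j).mulVec x =
          ∑ k, (E i).mulVec x k * (E j).mulVec x k := by
        intro i j
        rw [← Matrix.mulVec_mulVec, Matrix.dotProduct_mulVec, ← Matrix.mulVec_transpose,
          (hD i).eq]
        rfl
      simp only [star_trivial, Matrix.sum_mulVec, dotProduct_sum, Matrix.smul_mulVec,
        dotProduct_smul, hij, smul_eq_mul, Finset.mul_sum]
      rw [Finset.sum_congr rfl fun i _ => Finset.sum_comm]
      exact Finset.sum_comm
    rw [this]
    exact Finset.sum_nonneg fun k _ => hA fun i => (E i).mulVec x k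

end NCHess

end


theorem corollary1p5 (g : ℕ) (p : NCHess.NCPoly g) (hp : star p = p)
    (N : ∀ n : ℕ, Seminorm ℝ (NCHess.SymTuple g n))
    (hN : ∀ (n : ℕ) (X : NCHess.SymTuple g n), N n X = 0 → X = 0)
    (hpos : ∃ ε : ℝ, 0 < ε ∧ NCHess.RelaxedHessianPosOn p (NCHess.ncNhd N ε)) :
    NCHess.degree p ≤ 2 ∧ NCHess.MatrixConvex p := by
  obtain ⟨ε, hε, hpos⟩ := hpos
  have hd := NCHess.degree_le_two hp hε hpos
  exact ⟨hd, NCHess.matrixConvex_of_degree_le_two hp hd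
    (NCHess.quadratic_coef_nonneg hε hpos hd)⟩
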